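/- Let $A$ be an $f$-algebra (a real vector lattice with an associative bilinear multiplication, not necessarily with unit, such that products of positive elements are positive and $a\wedge b=0$, $c\ge 0$ imply $(ca)\wedge b=(ac)\wedge b=0$). Let $A^{\sim}$ be its order dual, i.e. the vector lattice of all order bounded linear functionals on $A$, and assume that $A^{\sim}$ separates the points of $A$. Let $(A^{\sim})^{\sim}_{n}$ be the vector lattice of all order bounded, order continuous linear functionals on $A^{\sim}$, and for $x\in A$ let $x''\in(A^{\sim})^{\sim}_{n}$ be given by $x''(g)=g(x)$. For $f\in A^{\sim}$, $a\in A$ and $F\in(A^{\sim})^{\sim}_{n}$ define $f\cdot a\in A^{\sim}$ and $F\cdot f\in A^{\sim}$ by $$(f\cdot a)(b)=f(ab)\quad(b\in A),\qquad (F\cdot f)(a)=F(f\cdot a)\quad(a\in A),$$ and let $T_f:(A^{\sim})^{\sim}_{n}\to A^{\sim}$, $T_f(F)=F\cdot f$. Let $0\le f\in A^{\sim}$. Then $T_f$ is an interval preserving lattice homomorphism; that is, $T_f$ is linear and positive, $T_f[0,F]=[0,T_f(F)]$ for all $0\le F\in(A^{\sim})^{\sim}_{n}$, and $T_f(F\vee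 G)=T_f(F)\vee T_f(G)$, $T_f(F\wedge G)=T_f(F)\wedge T_f(G)$ for all $F,G\in(A^{\sim})^{\sim}_{n}$. Moreover, when $A$ is regarded as a subset of $(A^{\sim})^{\sim}_{n}$ through $x\mapsto x''$, the restriction of $T_f$ to $A$ is the map $S_f:A\to A^{\sim}$, $S_f(a)=f\cdot a$, that is, $T_f(a'')=f\cdot a$ for all $a\in A$; the operator $S_f$ is order bounded, and its order adjoint $S_f':(A^{\sim})^{\sim}\to A^{\sim}$, $S_f'(F)=F\circ S_f$, coincides with $T_f$ on $(A^{\sim})^{\sim}_{n}$. -/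

import Mathlib

/-
Riesz spaces (real vector lattices) `E` are given by the instances
`[AddCommGroup E] [Lattice E] [IsOrderedAddMonoid E] [Module ℝ E] [PosSMulMono ℝ E]`.
-/

set_option linter.unusedSectionVars false

universe u v

open Set Filter Topology

section OperatorNotions

variable {E : Type u} {F : Type v}

/-- An operator is order bounded if it maps order intervals into order intervals. -/
def IsOrderBounded [AddCommGroup E] [PartialOrder E] [Module ℝ E]
    [AddCommGroup F] [PartialOrder F] [Module ℝ F] (T : E →ₗ[ℝ] F) : Prop :=
  ∀ u v : E, ∃ w z : F, ∀ x ∈ Icc u v, T x ∈ Icc w z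

/-- Order convergence of the net `x` to `l`: there is a net `y`, decreasing with infimum `0`, on
the same index set, such that `|x i - l| ≤ y i` for all `i`. -/
def OrderConverges [AddCommGroup E] [Lattice E] {ι : Type*} [Preorder ι]
    (x : ι → E) (l : E) : Prop :=
  ∃ y : ι → E, Antitone y ∧ IsGLB (range y) 0 ∧ ∀ i, |x i - l| ≤ y i

/-- An operator is order continuous if it maps nets that are order convergent to `0` to nets that
are order convergent to `0`. -/
def IsOrderContinuous [AddCommGroup E] [Lattice E] [Module ℝ E]
    [AddCommGroup F] [Lattice F] [Module ℝ F] (T : E →ₗ[ℝ] F) : Prop :=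
  ∀ (ι : Type u) [Preorder ι] [IsDirectedOrder ι] [Nonempty ι] (x : ι → E),
    OrderConverges x 0 → OrderConverges (fun i => T (x i)) 0

/-- Lattice homomorphisms (Riesz homomorphisms). -/
structure IsLatticeHomomorphism [AddCommGroup E] [Lattice E] [Module ℝ E]
    [AddCommGroup F] [Lattice F] [Module ℝ F] (T : E →ₗ[ℝ] F) : Prop where
  map_sup : ∀ x y : E, T (x ⊔ y) = T x ⊔ T y
  map_inf : ∀ x y : E, T (x ⊓ y) = T x ⊓ T y

/-- `T` is positive and `T [0, x] = [0, T x]` for all `x ≥ 0`. -/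
structure IsIntervalPreserving [AddCommGroup E] [PartialOrder E] [Module ℝ E]
    [AddCommGroup F] [PartialOrder F] [Module ℝ F] (T : E →ₗ[ℝ] F) : Prop where
  nonneg : ∀ x : E, 0 ≤ x → 0 ≤ T x
  image_Icc : ∀ x : E, 0 ≤ x → T '' Icc 0 x = Icc 0 (T x)

end OperatorNotions

section OrdDualDefs

variable (E : Type u) [AddCommGroup E] [Lattice E] [IsOrderedAddMonoid E] [Module ℝ E]

/-- The order bounded linear functionals on `E`, as a subspace of the algebraic dual. -/
def orderBoundedFunctionals : Submodule ℝ (E →ₗ[ℝ] ℝ) where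
  carrier := {φ | IsOrderBounded φ}
  add_mem' := by
    intro φ ψ hφ hψ u v
    obtain ⟨w, z, h⟩ := hφ u v
    obtain ⟨w', z', h'⟩ := hψ u v
    exact ⟨w + w', z + z', fun x hx =>
      ⟨add_le_add (h x hx).1 (h' x hx).1, add_le_add (h x hx).2 (h' x hx).2⟩⟩
  zero_mem' := fun u v => ⟨0, 0, fun x _ => by simp⟩
  smul_mem' := by
    intro c φ hφ u v
    obtain ⟨w, z, h⟩ := hφ u v
    rcases le_total 0 c with hc | hc
    · exact ⟨c * w, c * z, fun x hx =>
        ⟨mul_le_mul_of_nonneg_left (h x hx).1 hc, mul_le_mul_of_nonneg_left (h x hx).2 hc⟩⟩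
    · exact ⟨c * z, c * w, fun x hx =>
        ⟨mul_le_mul_of_nonpos_left (h x hx).2 hc, mul_le_mul_of_nonpos_left (h x hx).1 hc⟩⟩

/-- The order dual `E~` of a Riesz space `E`: the order bounded linear functionals. -/
def OrdDual : Type u := ↥(orderBoundedFunctionals E)

noncomputable instance : AddCommGroup (OrdDual E) :=
  inferInstanceAs (AddCommGroup ↥(orderBoundedFunctionals E))

noncomputable instance : Module ℝ (OrdDual E) :=
  inferInstanceAs (Module ℝ ↥(orderBoundedFunctionals E))

end OrdDualDefs

namespace OrdDual

section Basic

variable {E : Type u} [AddCommGroup E] [Lattice E] [IsOrderedAddMonoid E] [Module ℝ E]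

/-- The underlying linear functional. -/
def toLin (φ : OrdDual E) : E →ₗ[ℝ] ℝ := φ.1

theorem isOrderBounded (φ : OrdDual E) : IsOrderBounded φ.toLin := φ.2

instance : CoeFun (OrdDual E) (fun _ => E → ℝ) := ⟨fun φ => φ.toLin⟩

/-- An order bounded linear functional as an element of the order dual. -/
def mk (φ : E →ₗ[ℝ] ℝ) (h : IsOrderBounded φ) : OrdDual E := ⟨φ, h⟩

@[simp] theorem mk_apply (φ : E →ₗ[ℝ] ℝ) (h : IsOrderBounded φ) (x : E) : mk φ h x = φ x := rfl
@[simp] theorem add_apply (φ ψ : OrdDual E) (x : E) : (φ + ψ) x = φ x + ψ x := rfl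
@[simp] theorem sub_apply (φ ψ : OrdDual E) (x : E) : (φ - ψ) x = φ x - ψ x := rfl
@[simp] theorem neg_apply (φ : OrdDual E) (x : E) : (-φ) x = - φ x := rfl
@[simp] theorem zero_apply (x : E) : (0 : OrdDual E) x = 0 := rfl
@[simp] theorem smul_apply (c : ℝ) (φ : OrdDual E) (x : E) : (c • φ) x = c * φ x := rfl

theorem decomp (φ : OrdDual E) (x : E) : φ x = φ x⁺ - φ x⁻ := by
  rw [← map_sub, posPart_sub_negPart]

theorem ext_nonneg {φ ψ : OrdDual E} (h : ∀ x, 0 ≤ x → φ x = ψ x) : φ = ψ := by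
  refine Subtype.ext (LinearMap.ext fun x => ?_)
  change φ x = ψ x
  rw [decomp φ, decomp ψ, h _ (posPart_nonneg x), h _ (negPart_nonneg x)]

/-- The order of the order dual: `φ ≤ ψ` iff `φ x ≤ ψ x` for all `x ≥ 0`. -/
instance : PartialOrder (OrdDual E) where
  le φ ψ := ∀ x : E, 0 ≤ x → φ x ≤ ψ x
  le_refl _ _ _ := le_rfl
  le_trans _ _ _ h h' x hx := (h x hx).trans (h' x hx)
  le_antisymm _ _ h h' := ext_nonneg fun x hx => le_antisymm (h x hx) (h' x hx)

theorem le_def {φ ψ : OrdDual E} : φ ≤ ψ ↔ ∀ x : E, 0 ≤ x → φ x ≤ ψ x := Iff.rfl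

instance : IsOrderedAddMonoid (OrdDual E) where
  add_le_add_left _ _ h _ x hx := by simpa using h x hx

instance : PosSMulMono ℝ (OrdDual E) where
  smul_le_smul_of_nonneg_left _ hc _ _ h x hx := mul_le_mul_of_nonneg_left (h x hx) hc

theorem mono {φ : OrdDual E} (hφ : 0 ≤ φ) {x y : E} (h : x ≤ y) : φ x ≤ φ y := by
  have := hφ (y - x) (sub_nonneg.2 h)
  simpa using this

end Basic

section Riesz

variable {E : Type u} [AddCommGroup E] [Lattice E] [IsOrderedAddMonoid E] [Module ℝ E]
  [PosSMulMono ℝ E]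

/-- An additive, positively homogeneous function on the positive cone extends to `E`. -/
theorem exists_extension (p : E → ℝ)
    (hadd : ∀ x y, 0 ≤ x → 0 ≤ y → p (x + y) = p x + p y)
    (hsmul : ∀ c : ℝ, ∀ x, 0 ≤ c → 0 ≤ x → p (c • x) = c * p x) :
    ∃ φ : E →ₗ[ℝ] ℝ, ∀ x, 0 ≤ x → φ x = p x := by
  have key : ∀ x a b : E, 0 ≤ a → 0 ≤ b → x = a - b → p x⁺ - p x⁻ = p a - p b := by
    intro x a b ha hb h
    have h1 : a + x⁻ = b + x⁺ := by
      have h2 := posPart_sub_negPart x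
      have h3 : x⁺ = a - b + x⁻ := by rw [← h]; exact sub_eq_iff_eq_add.1 h2
      rw [h3]; abel
    have h4 := hadd a x⁻ ha (negPart_nonneg x)
    have h5 := hadd b x⁺ hb (posPart_nonneg x)
    rw [h1] at h4
    linarith
  have hadd' : ∀ x y : E, p (x + y)⁺ - p (x + y)⁻ = p x⁺ - p x⁻ + (p y⁺ - p y⁻) := by
    intro x y
    rw [key (x + y) (x⁺ + y⁺) (x⁻ + y⁻) (add_nonneg (posPart_nonneg x) (posPart_nonneg y))
      (add_nonneg (negPart_nonneg x) (negPart_nonneg y)),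
      hadd _ _ (posPart_nonneg x) (posPart_nonneg y),
      hadd _ _ (negPart_nonneg x) (negPart_nonneg y)]
    · ring
    · conv_lhs => rw [← posPart_sub_negPart x, ← posPart_sub_negPart y]
      abel
  have hsmul' : ∀ (c : ℝ) (x : E), p (c • x)⁺ - p (c • x)⁻ = c * (p x⁺ - p x⁻) := by
    intro c x
    rcases le_total 0 c with hc | hc
    · rw [key (c • x) (c • x⁺) (c • x⁻) (smul_nonneg hc (posPart_nonneg x))
        (smul_nonneg hc (negPart_nonneg x)), hsmul _ _ hc (posPart_nonneg x),
        hsmul _ _ hc (negPart_nonneg x)]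
      · ring
      · rw [← smul_sub, posPart_sub_negPart]
    · have hc' : 0 ≤ -c := neg_nonneg.2 hc
      rw [key (c • x) ((-c) • x⁻) ((-c) • x⁺) (smul_nonneg hc' (negPart_nonneg x))
        (smul_nonneg hc' (posPart_nonneg x)), hsmul _ _ hc' (posPart_nonneg x),
        hsmul _ _ hc' (negPart_nonneg x)]
      · ring
      · conv_lhs => rw [← posPart_sub_negPart x]
        rw [← smul_sub, neg_smul, ← smul_neg, neg_sub]
  refine ⟨{ toFun := fun x => p x⁺ - p x⁻, map_add' := hadd', map_smul' := hsmul' }, ?_⟩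
  intro x hx
  change p x⁺ - p x⁻ = p x
  have h0 : p 0 = 0 := by simpa using hsmul 0 0 le_rfl le_rfl
  rw [key x x 0 hx le_rfl (by simp), h0, sub_zero]

/-- A positive linear functional is order bounded. -/
theorem isOrderBounded_of_nonneg (φ : E →ₗ[ℝ] ℝ) (h : ∀ x, 0 ≤ x → 0 ≤ φ x) :
    IsOrderBounded φ := fun u v => ⟨φ u, φ v, fun x hx => by
  have h1 := h (x - u) (sub_nonneg.2 hx.1)
  have h2 := h (v - x) (sub_nonneg.2 hx.2)
  rw [map_sub] at h1 h2
  exact ⟨by linarith, by linarith⟩⟩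

theorem bddAbove_image (φ : OrdDual E) (x : E) : BddAbove (φ '' Icc 0 x) := by
  obtain ⟨w, z, h⟩ := φ.isOrderBounded 0 x
  exact ⟨z, by rintro _ ⟨y, hy, rfl⟩; exact (h y hy).2⟩

/-- The Riesz-Kantorovich formula for the positive part of an order bounded functional. -/
theorem exists_pos (φ : OrdDual E) :
    ∃ ψ : OrdDual E, ∀ x, 0 ≤ x → ψ x = sSup (φ '' Icc 0 x) := by
  have hne : ∀ x : E, 0 ≤ x → (φ '' Icc 0 x).Nonempty := fun x hx =>
    ⟨φ 0, 0, ⟨le_rfl, hx⟩, rfl⟩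
  have hle : ∀ {x y : E}, 0 ≤ y → y ≤ x → φ y ≤ sSup (φ '' Icc 0 x) := fun {x y} h1 h2 =>
    le_csSup (bddAbove_image φ x) ⟨y, ⟨h1, h2⟩, rfl⟩
  obtain ⟨ψ, hψ⟩ := exists_extension (fun x => sSup (φ '' Icc 0 x))
    (by
      intro x y hx hy
      apply le_antisymm
      · apply csSup_le (hne _ (add_nonneg hx hy))
        rintro _ ⟨z, ⟨hz0, hz⟩, rfl⟩
        have h1 : φ (z ⊓ x) ≤ _ := hle (le_inf hz0 hx) inf_le_right
        have h2 : φ (z - z ⊓ x) ≤ sSup (φ '' Icc 0 y) := by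
          apply hle (sub_nonneg.2 inf_le_left)
          rw [sub_le_iff_le_add, ← sub_le_iff_le_add']
          refine le_inf ?_ ?_
          · exact sub_le_self _ hy
          · exact sub_le_iff_le_add.2 hz
        rw [map_sub] at h2
        change φ z ≤ _
        linarith
      · rw [← le_sub_iff_add_le]
        apply csSup_le (hne _ hx)
        rintro _ ⟨a, ⟨ha0, ha⟩, rfl⟩
        rw [le_sub_comm]
        apply csSup_le (hne _ hy)
        rintro _ ⟨b, ⟨hb0, hb⟩, rfl⟩
        have : φ (a + b) ≤ sSup (φ '' Icc 0 (x + y)) :=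
          hle (add_nonneg ha0 hb0) (add_le_add ha hb)
        rw [map_add] at this
        linarith)
    (by
      intro c x hc hx
      have aux : ∀ (c : ℝ) (x : E), 0 ≤ c → 0 ≤ x →
          c * sSup (φ '' Icc 0 x) ≤ sSup (φ '' Icc 0 (c • x)) := by
        intro c x hc hx
        rcases hc.eq_or_lt with rfl | hc'
        · rw [zero_mul]
          exact (map_zero φ.toLin).ge.trans
            (hle (x := (0 : ℝ) • x) (y := 0) le_rfl (by rw [zero_smul]))
        · rw [← le_div_iff₀' hc']
          apply csSup_le (hne _ hx)
          rintro _ ⟨a, ⟨ha0, ha⟩, rfl⟩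
          rw [le_div_iff₀' hc']
          have : φ (c • a) ≤ sSup (φ '' Icc 0 (c • x)) :=
            hle (smul_nonneg hc ha0) (smul_le_smul_of_nonneg_left ha hc)
          rwa [map_smul] at this
      refine le_antisymm ?_ (aux c x hc hx)
      rcases hc.eq_or_lt with rfl | hc'
      · simp
      · have := aux c⁻¹ (c • x) (inv_nonneg.2 hc) (smul_nonneg hc hx)
        rw [smul_smul, inv_mul_cancel₀ hc'.ne', one_smul] at this
        rwa [inv_mul_le_iff₀ hc'] at this)
  refine ⟨mk ψ (isOrderBounded_of_nonneg ψ fun x hx => ?_), hψ⟩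
  rw [hψ x hx]
  simpa using hle (x := x) (y := 0) le_rfl hx

/-- The positive part of an order bounded functional. -/
noncomputable def pos (φ : OrdDual E) : OrdDual E := (exists_pos φ).choose

theorem pos_apply (φ : OrdDual E) {x : E} (hx : 0 ≤ x) : pos φ x = sSup (φ '' Icc 0 x) :=
  (exists_pos φ).choose_spec x hx

theorem le_pos_apply (φ : OrdDual E) {x y : E} (hy : 0 ≤ y) (h : y ≤ x) : φ y ≤ pos φ x := by
  rw [pos_apply φ (hy.trans h)]
  exact le_csSup (bddAbove_image φ x) ⟨y, ⟨hy, h⟩, rfl⟩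

theorem pos_apply_le (φ : OrdDual E) {x : E} (hx : 0 ≤ x) {c : ℝ}
    (h : ∀ y, 0 ≤ y → y ≤ x → φ y ≤ c) : pos φ x ≤ c := by
  rw [pos_apply φ hx]
  refine csSup_le ⟨φ 0, 0, ⟨le_rfl, hx⟩, rfl⟩ ?_
  rintro _ ⟨y, hy, rfl⟩
  exact h y hy.1 hy.2

theorem pos_nonneg (φ : OrdDual E) : 0 ≤ pos φ := fun x hx => by
  simpa using le_pos_apply φ (le_refl (0 : E)) hx

/-- The order dual of a Riesz space is a lattice. -/
noncomputable instance : Lattice (OrdDual E) where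
  sup φ ψ := ψ + pos (φ - ψ)
  inf φ ψ := φ - pos (φ - ψ)
  le_sup_left φ ψ x hx := by
    have := le_pos_apply (φ - ψ) hx le_rfl
    simp only [sub_apply, add_apply] at *
    linarith
  le_sup_right φ ψ x hx := by
    have := pos_nonneg (φ - ψ) x hx
    simp only [add_apply, zero_apply] at *
    linarith
  sup_le φ ψ χ h1 h2 x hx := by
    have : pos (φ - ψ) x ≤ χ x - ψ x := by
      refine pos_apply_le _ hx fun y hy hyx => ?_
      have h3 := h1 y hy
      have h4 := h2 (x - y) (sub_nonneg.2 hyx)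
      simp only [sub_apply, map_sub] at *
      linarith
    simp only [add_apply]
    linarith
  inf_le_left φ ψ x hx := by
    have := pos_nonneg (φ - ψ) x hx
    simp only [sub_apply, zero_apply] at *
    linarith
  inf_le_right φ ψ x hx := by
    have := le_pos_apply (φ - ψ) hx le_rfl
    simp only [sub_apply] at *
    linarith
  le_inf χ φ ψ h1 h2 x hx := by
    have : pos (φ - ψ) x ≤ φ x - χ x := by
      refine pos_apply_le _ hx fun y hy hyx => ?_
      have h3 := h2 y hy
      have h4 := h1 (x - y) (sub_nonneg.2 hyx)
      simp only [sub_apply, map_sub] at *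
      linarith
    simp only [sub_apply]
    linarith

theorem sup_eq (φ ψ : OrdDual E) : φ ⊔ ψ = ψ + pos (φ - ψ) := rfl
theorem inf_eq (φ ψ : OrdDual E) : φ ⊓ ψ = φ - pos (φ - ψ) := rfl

theorem abs_apply_le (φ : OrdDual E) (x : E) : |φ x| ≤ |φ| |x| := by
  have h : ∀ ψ : OrdDual E, ψ ≤ |φ| → -ψ ≤ |φ| → ψ x ≤ |φ| |x| := by
    intro ψ h1 h2
    have e1 := h1 x⁺ (posPart_nonneg x)
    have e2 := h2 x⁻ (negPart_nonneg x)
    rw [decomp ψ, ← posPart_add_negPart x, map_add]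
    simp only [neg_apply] at e2
    linarith
  rw [abs_le']
  refine ⟨h φ (le_abs_self φ) (neg_le_abs φ), ?_⟩
  exact h (-φ) (neg_le_abs φ) (by rw [neg_neg]; exact le_abs_self φ)

end Riesz

end OrdDual

section Adjoint

variable {E : Type u} {F : Type v} [AddCommGroup E] [Lattice E] [IsOrderedAddMonoid E]
  [Module ℝ E] [AddCommGroup F] [Lattice F] [IsOrderedAddMonoid F] [Module ℝ F]

/-- The order adjoint `T' : F~ → E~`, `T' φ = φ ∘ T`, of an order bounded operator `T`. -/
noncomputable def orderAdjoint (T : E →ₗ[ℝ] F) (hT : IsOrderBounded T) : OrdDual F →ₗ[ℝ] OrdDual E where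
  toFun φ := OrdDual.mk (φ.toLin ∘ₗ T) fun u v => by
    obtain ⟨w, z, h⟩ := hT u v
    obtain ⟨w', z', h'⟩ := φ.isOrderBounded w z
    exact ⟨w', z', fun x hx => h' _ (h x hx)⟩
  map_add' _ _ := rfl
  map_smul' _ _ := rfl

end Adjoint

section OCont

variable (E : Type u) [AddCommGroup E] [Lattice E] [IsOrderedAddMonoid E] [Module ℝ E]

/-- The order continuous functionals among the order bounded ones. -/
def orderContinuousFunctionals : Submodule ℝ (OrdDual E) where
  carrier := {φ | IsOrderContinuous φ.toLin}
  add_mem' := by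
    intro φ ψ hφ hψ ι _ _ _ x hx
    obtain ⟨y, hy, hy0, hxy⟩ := hφ ι x hx
    obtain ⟨z, hz, hz0, hxz⟩ := hψ ι x hx
    refine ⟨y + z, hy.add hz, ⟨?_, ?_⟩, fun i => ?_⟩
    · rintro _ ⟨i, rfl⟩
      exact add_nonneg (hy0.1 ⟨i, rfl⟩) (hz0.1 ⟨i, rfl⟩)
    · intro c hc
      by_contra h
      push Not at h
      have h1 : ∃ i, y i < c / 2 := by
        by_contra! h'
        have : c / 2 ≤ 0 := hy0.2 (by rintro _ ⟨i, rfl⟩; exact h' i)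
        linarith
      have h2 : ∃ i, z i < c / 2 := by
        by_contra! h'
        have : c / 2 ≤ 0 := hz0.2 (by rintro _ ⟨i, rfl⟩; exact h' i)
        linarith
      obtain ⟨i, hi⟩ := h1
      obtain ⟨j, hj⟩ := h2
      obtain ⟨k, hik, hjk⟩ := exists_ge_ge i j
      have h3 : c ≤ y k + z k := hc ⟨k, rfl⟩
      have := hy hik
      have := hz hjk
      linarith
    · have h1 := hxy i
      have h2 := hxz i
      simp only [sub_zero] at *
      exact (abs_add_le _ _).trans (add_le_add h1 h2)
  zero_mem' := by
    intro ι _ _ _ x _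
    refine ⟨fun _ => 0, antitone_const, ?_, fun i => ?_⟩
    · simp
    · change |(0 : ℝ) - 0| ≤ 0
      simp
  smul_mem' := by
    intro c φ hφ ι _ _ _ x hx
    obtain ⟨y, hy, hy0, hxy⟩ := hφ ι x hx
    refine ⟨fun i => |c| * y i, fun i j h => mul_le_mul_of_nonneg_left (hy h) (abs_nonneg c),
      ⟨?_, ?_⟩, fun i => ?_⟩
    · rintro _ ⟨i, rfl⟩
      exact mul_nonneg (abs_nonneg c) (hy0.1 ⟨i, rfl⟩)
    · intro d hd
      rcases (abs_nonneg c).eq_or_lt with h | h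
      · have := hd ⟨Classical.arbitrary ι, rfl⟩
        simpa [← h] using this
      · have : d / |c| ≤ 0 := hy0.2 (by
          rintro _ ⟨i, rfl⟩
          rw [div_le_iff₀' h]
          exact hd ⟨i, rfl⟩)
        rw [div_le_iff₀ h] at this
        simpa using this
    · have h1 := hxy i
      simp only [sub_zero] at *
      change |c * φ (x i)| ≤ _
      rw [abs_mul]
      exact mul_le_mul_of_nonneg_left h1 (abs_nonneg c)

/-- The order continuous dual `E~_n`: the order bounded functionals on `E` that are order
continuous. -/
def OrdContDual : Type u := ↥(orderContinuousFunctionals E)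

noncomputable instance : AddCommGroup (OrdContDual E) :=
  inferInstanceAs (AddCommGroup ↥(orderContinuousFunctionals E))

noncomputable instance : Module ℝ (OrdContDual E) :=
  inferInstanceAs (Module ℝ ↥(orderContinuousFunctionals E))

/-- The inclusion of `E~_n` in `E~`. -/
noncomputable def OrdContDual.incl : OrdContDual E →ₗ[ℝ] OrdDual E := (orderContinuousFunctionals E).subtype

/-- The order that `E~_n` inherits from `E~`. -/
instance : PartialOrder (OrdContDual E) :=
  inferInstanceAs (PartialOrder {φ : OrdDual E // φ ∈ orderContinuousFunctionals E})

instance : IsOrderedAddMonoid (OrdContDual E) where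
  add_le_add_left φ ψ h χ := by
    have h' : φ.1 ≤ ψ.1 := h
    exact add_le_add_left h' χ.1

instance : PosSMulMono ℝ (OrdContDual E) where
  smul_le_smul_of_nonneg_left c hc φ ψ h := by
    have h' : φ.1 ≤ ψ.1 := h
    have h'' : c • φ.1 ≤ c • ψ.1 := smul_le_smul_of_nonneg_left h' hc
    exact h''

variable {E}

theorem OrdDual.pos_mem_orderContinuous [PosSMulMono ℝ E] (φ : OrdDual E)
    (hφ : φ ∈ orderContinuousFunctionals E) :
    OrdDual.pos φ ∈ orderContinuousFunctionals E := by
  intro ι _ _ _ x hx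
  obtain ⟨y, hy, hy0, hxy⟩ := hx
  have hynn : ∀ i, 0 ≤ y i := fun i => hy0.1 ⟨i, rfl⟩
  refine ⟨fun i => pos φ (y i), fun i j h => mono (pos_nonneg φ) (hy h), ⟨?_, ?_⟩, fun i => ?_⟩
  · rintro _ ⟨i, rfl⟩
    exact pos_nonneg φ _ (hynn i)
  · intro c hc
    have hc' : ∀ i, c ≤ pos φ (y i) := fun i => hc ⟨i, rfl⟩
    obtain ⟨i₀⟩ := ‹Nonempty ι›
    by_contra h
    push Not at h
    -- approximate the value at the starting index by an element of the interval
    have h1 : ∃ a, 0 ≤ a ∧ a ≤ y i₀ ∧ pos φ (y i₀) - c / 2 < φ a := by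
      by_contra! h'
      have := pos_apply_le φ (hynn i₀) h'
      linarith
    obtain ⟨a, ha0, ha, hφa⟩ := h1
    have hconv : OrderConverges (fun i => a ⊓ y i) 0 := by
      refine ⟨y, hy, hy0, fun i => ?_⟩
      rw [sub_zero, abs_of_nonneg (le_inf ha0 (hynn i))]
      exact inf_le_right
    obtain ⟨z, hz, hz0, haz⟩ := hφ ι _ hconv
    have h2 : ∃ i, z i < c / 2 := by
      by_contra! h'
      have : c / 2 ≤ 0 := hz0.2 (by rintro _ ⟨i, rfl⟩; exact h' i)
      linarith
    obtain ⟨i, hi⟩ := h2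
    obtain ⟨k, hik, hk⟩ := exists_ge_ge i i₀
    have e1 := haz k
    rw [sub_zero] at e1
    have e1' : φ (a ⊓ y k) ≤ z k := (le_abs_self _).trans e1
    have e2 := hz hik
    have e3 : φ (a - a ⊓ y k) ≤ pos φ (y i₀ - y k) := by
      apply le_pos_apply φ (sub_nonneg.2 inf_le_left)
      rw [sub_le_iff_le_add, ← sub_le_iff_le_add']
      refine le_inf ?_ ?_
      · exact sub_le_self _ (sub_nonneg.2 (hy hk))
      · rw [sub_le_iff_le_add]
        simpa using ha
    rw [map_sub, map_sub] at e3
    have e4 := hc' k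
    linarith
  · rw [sub_zero]
    have h1 := hxy i
    rw [sub_zero] at h1
    refine abs_le.2 ⟨?_, mono (pos_nonneg φ) ((le_abs_self _).trans h1)⟩
    have := mono (pos_nonneg φ) ((neg_le_abs (x i)).trans h1)
    rw [map_neg] at this
    change - pos φ (y i) ≤ pos φ (x i)
    linarith

/-- `E~_n` is a sublattice of `E~`, and carries the lattice operations of `E~`. -/
noncomputable instance [PosSMulMono ℝ E] : Lattice (OrdContDual E) where
  sup φ ψ := ⟨φ.1 ⊔ ψ.1, Submodule.add_mem _ ψ.2
    (OrdDual.pos_mem_orderContinuous _ (Submodule.sub_mem _ φ.2 ψ.2))⟩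
  inf φ ψ := ⟨φ.1 ⊓ ψ.1, Submodule.sub_mem _ φ.2
    (OrdDual.pos_mem_orderContinuous _ (Submodule.sub_mem _ φ.2 ψ.2))⟩
  le_sup_left φ ψ := le_sup_left (a := φ.1) (b := ψ.1)
  le_sup_right φ ψ := le_sup_right (a := φ.1) (b := ψ.1)
  sup_le φ ψ χ h1 h2 := sup_le (a := φ.1) (b := ψ.1) (c := χ.1) h1 h2
  inf_le_left φ ψ := inf_le_left (a := φ.1) (b := ψ.1)
  inf_le_right φ ψ := inf_le_right (a := φ.1) (b := ψ.1)
  le_inf φ ψ χ h1 h2 := le_inf (c := φ.1) (a := ψ.1) (b := χ.1) h1 h2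

end OCont

section Canonical

variable {E : Type u} [AddCommGroup E] [Lattice E] [IsOrderedAddMonoid E] [Module ℝ E]
  [PosSMulMono ℝ E]

theorem isOrderBounded_eval (x : E) :
    IsOrderBounded ({ toFun := fun φ => φ x, map_add' := fun _ _ => rfl,
                      map_smul' := fun _ _ => rfl } : OrdDual E →ₗ[ℝ] ℝ) := by
  intro φ ψ
  refine ⟨φ x⁺ - ψ x⁻, ψ x⁺ - φ x⁻, fun χ hχ => ?_⟩
  change χ x ∈ _
  rw [OrdDual.decomp χ]
  exact ⟨sub_le_sub (hχ.1 _ (posPart_nonneg x)) (hχ.2 _ (negPart_nonneg x)),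
    sub_le_sub (hχ.2 _ (posPart_nonneg x)) (hχ.1 _ (negPart_nonneg x))⟩

/-- A downward directed net in the order dual with infimum `0` converges pointwise to `0` on the
positive cone. -/
theorem OrdDual.isGLB_apply {ι : Type*} [Preorder ι] [IsDirectedOrder ι] [Nonempty ι]
    (y : ι → OrdDual E) (hy : Antitone y) (hy0 : IsGLB (range y) 0) (x : E) (hx : 0 ≤ x) :
    IsGLB (range fun i => y i x) 0 := by
  have hnn : ∀ i, 0 ≤ y i := fun i => hy0.1 ⟨i, rfl⟩
  have hbdd : ∀ x : E, 0 ≤ x → BddBelow (range fun i => y i x) := fun x hx =>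
    ⟨0, by rintro _ ⟨i, rfl⟩; exact hnn i x hx⟩
  have hanti : ∀ x : E, 0 ≤ x → Antitone fun i => y i x := fun x hx i j h => hy h x hx
  have hlim : ∀ x : E, 0 ≤ x → Tendsto (fun i => y i x) atTop (𝓝 (⨅ i, y i x)) := fun x hx =>
    tendsto_atTop_ciInf (hanti x hx) (hbdd x hx)
  obtain ⟨φ, hφ⟩ := OrdDual.exists_extension (fun x => ⨅ i, y i x)
    (by
      intro a b ha hb
      refine tendsto_nhds_unique (hlim _ (add_nonneg ha hb)) ?_
      simpa using (hlim a ha).add (hlim b hb))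
    (by
      intro c a hc ha
      refine tendsto_nhds_unique (hlim _ (smul_nonneg hc ha)) ?_
      simpa using (hlim a ha).const_mul c)
  have hφb : IsOrderBounded φ := OrdDual.isOrderBounded_of_nonneg φ fun a ha => by
    rw [hφ a ha]
    exact le_ciInf fun i => hnn i a ha
  have h1 : OrdDual.mk φ hφb ≤ 0 := hy0.2 (by
    rintro _ ⟨i, rfl⟩ a ha
    change φ a ≤ y i a
    rw [hφ a ha]
    exact ciInf_le (hbdd a ha) i)
  have h2 : φ x ≤ 0 := h1 x hx
  rw [hφ x hx] at h2
  refine ⟨by rintro _ ⟨i, rfl⟩; exact hnn i x hx, fun c hc => ?_⟩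
  exact (le_ciInf fun i => hc ⟨i, rfl⟩).trans h2

/-- The canonical embedding `x ↦ x''` of `E` in `(E~)~_n`, given by `x'' φ = φ x`. -/
noncomputable def canonicalEmbedding : E →ₗ[ℝ] OrdContDual (OrdDual E) where
  toFun x := ⟨OrdDual.mk { toFun := fun φ => φ x, map_add' := fun _ _ => rfl,
                           map_smul' := fun _ _ => rfl } (isOrderBounded_eval x), by
    intro ι _ _ _ f hf
    obtain ⟨y, hy, hy0, hfy⟩ := hf
    refine ⟨fun i => y i |x|, fun i j h => hy h _ (abs_nonneg x),
      OrdDual.isGLB_apply y hy hy0 _ (abs_nonneg x), fun i => ?_⟩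
    rw [sub_zero]
    have h1 := hfy i
    rw [sub_zero] at h1
    exact (OrdDual.abs_apply_le (f i) x).trans (h1 _ (abs_nonneg x))⟩
  map_add' x y := Subtype.ext (Subtype.ext (LinearMap.ext fun φ => map_add φ.toLin x y))
  map_smul' c x := Subtype.ext (Subtype.ext (LinearMap.ext fun φ => map_smul φ.toLin c x))

end Canonical

/-- An `f`-algebra: a Riesz space with an associative bilinear multiplication (no unit is assumed,
and commutativity is not part of the definition) such that products of positive elements are
positive, and `a ⊓ b = 0` with `c ≥ 0` implies `(c * a) ⊓ b = 0` and `(a * c) ⊓ b = 0`. -/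
class FAlgebra (A : Type u) [NonUnitalRing A] [Lattice A] [Module ℝ A] : Prop
    extends IsOrderedAddMonoid A, PosSMulMono ℝ A, IsScalarTower ℝ A A, SMulCommClass ℝ A A where
  mul_nonneg : ∀ a b : A, 0 ≤ a → 0 ≤ b → 0 ≤ a * b
  mul_inf_eq_zero : ∀ a b c : A, a ⊓ b = 0 → 0 ≤ c → (c * a) ⊓ b = 0
  inf_mul_eq_zero : ∀ a b c : A, a ⊓ b = 0 → 0 ≤ c → (a * c) ⊓ b = 0

/-- The order dual of `E` separates the points of `E`, i.e. `°(E~) = {0}`. -/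
def HasSeparatingOrderDual (E : Type u) [AddCommGroup E] [Lattice E] [IsOrderedAddMonoid E]
    [Module ℝ E] : Prop :=
  ∀ x : E, (∀ φ : OrdDual E, φ x = 0) → x = 0

section Products

variable {A : Type u} [NonUnitalRing A] [Lattice A] [Module ℝ A] [FAlgebra A]

theorem isOrderBounded_mulLeft (a : A) : IsOrderBounded (LinearMap.mulLeft ℝ a) := by
  intro u v
  refine ⟨a⁺ * u - a⁻ * v, a⁺ * v - a⁻ * u, fun x hx => ?_⟩
  have hm : ∀ {c x y : A}, 0 ≤ c → x ≤ y → c * x ≤ c * y := fun {c x y} hc h => by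
    have := FAlgebra.mul_nonneg c (y - x) hc (sub_nonneg.2 h)
    rwa [mul_sub, sub_nonneg] at this
  have : LinearMap.mulLeft ℝ a x = a⁺ * x - a⁻ * x := by
    rw [← sub_mul, posPart_sub_negPart, LinearMap.mulLeft_apply]
  rw [this]
  exact ⟨sub_le_sub (hm (posPart_nonneg a) hx.1) (hm (negPart_nonneg a) hx.2),
    sub_le_sub (hm (posPart_nonneg a) hx.2) (hm (negPart_nonneg a) hx.1)⟩

/-- `f · a ∈ A~` for `f ∈ A~` and `a ∈ A`: `(f · a) b = f (a * b)`. -/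
def dualMul (f : OrdDual A) (a : A) : OrdDual A :=
  OrdDual.mk (f.toLin ∘ₗ LinearMap.mulLeft ℝ a) fun u v => by
    obtain ⟨w, z, h⟩ := isOrderBounded_mulLeft a u v
    obtain ⟨w', z', h'⟩ := f.isOrderBounded w z
    exact ⟨w', z', fun x hx => h' _ (h x hx)⟩

theorem dualMul_apply (f : OrdDual A) (a b : A) : dualMul f a b = f (a * b) := rfl

/-- The operator `A → A~`, `a ↦ f · a`. -/
noncomputable def dualMulMap (f : OrdDual A) : A →ₗ[ℝ] OrdDual A where
  toFun a := dualMul f a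
  map_add' a b := OrdDual.ext_nonneg fun x _ => by
    rw [OrdDual.add_apply]
    simp only [dualMul_apply]
    rw [add_mul, map_add]
  map_smul' c a := OrdDual.ext_nonneg fun x _ => by
    rw [RingHom.id_apply, OrdDual.smul_apply]
    simp only [dualMul_apply]
    rw [smul_mul_assoc, map_smul, smul_eq_mul]

theorem isOrderBounded_dualMulMap (f : OrdDual A) : IsOrderBounded (dualMulMap f) := by
  intro u v
  have hm : ∀ (g : OrdDual A), 0 ≤ g → ∀ {a b : A}, a ≤ b → dualMul g a ≤ dualMul g b := by
    intro g hg a b h x hx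
    rw [dualMul_apply, dualMul_apply]
    apply OrdDual.mono hg
    have := FAlgebra.mul_nonneg (b - a) x (sub_nonneg.2 h) hx
    rwa [sub_mul, sub_nonneg] at this
  refine ⟨dualMul f⁺ u - dualMul f⁻ v, dualMul f⁺ v - dualMul f⁻ u, fun a ha => ?_⟩
  have : dualMulMap f a = dualMul f⁺ a - dualMul f⁻ a := OrdDual.ext_nonneg fun x _ => by
    rw [OrdDual.sub_apply, dualMul_apply, dualMul_apply, ← OrdDual.sub_apply, posPart_sub_negPart]
    rfl
  rw [this]
  exact ⟨sub_le_sub (hm _ (posPart_nonneg f) ha.1) (hm _ (negPart_nonneg f) ha.2),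
    sub_le_sub (hm _ (posPart_nonneg f) ha.2) (hm _ (negPart_nonneg f) ha.1)⟩

/-- `F · f ∈ A~` for `F ∈ (A~)~_n` and `f ∈ A~`: `(F · f) a = F (f · a)`. -/
noncomputable def bidualMul (F : OrdContDual (OrdDual A)) (f : OrdDual A) : OrdDual A :=
  OrdDual.mk
    { toFun := fun a => OrdContDual.incl _ F (dualMul f a)
      map_add' := fun a b => by
        have := map_add (dualMulMap f) a b
        change dualMul f (a + b) = dualMul f a + dualMul f b at this
        rw [this, map_add]
      map_smul' := fun c a => by
        have := map_smul (dualMulMap f) c a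
        change dualMul f (c • a) = c • dualMul f a at this
        rw [this, map_smul, RingHom.id_apply] }
    fun u v => by
      obtain ⟨w, z, h⟩ := isOrderBounded_dualMulMap f u v
      obtain ⟨w', z', h'⟩ := (OrdContDual.incl _ F).isOrderBounded w z
      exact ⟨w', z', fun x hx => h' _ (h x hx)⟩

theorem bidualMul_apply (F : OrdContDual (OrdDual A)) (f : OrdDual A) (a : A) :
    bidualMul F f a = OrdContDual.incl _ F (dualMul f a) := rfl

/-- The operator `T_f : (A~)~_n → A~`, `T_f F = F · f`. -/
noncomputable def bidualMulMap (f : OrdDual A) : OrdContDual (OrdDual A) →ₗ[ℝ] OrdDual A where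
  toFun F := bidualMul F f
  map_add' _ _ := rfl
  map_smul' _ _ := rfl

end Products

/-! Three independent facts carry the theorem.

Lattice homomorphism. It suffices that `T_f` preserves disjointness. Multiplication by a positive
`a` is positive and band preserving, which gives `c • (a * x) ≤ (c² + c) • x + a * (a * x)` for all
`c ≥ 0` (`smul_le_of_bandPreserving`). Hence if a positive functional is small at `x`, it is small
at `a * x` as well: choose `c` large first. Two consequences follow. If `p ⊓ q = 0` and `F ≥ 0`,
then `F · p` and `q` are disjoint (`bidualMul_inf_eq_zero`); this is where order continuity of `F`
enters, along a sequence `p · z n` decreasing to `0`. If `F ⊓ G = 0`, split `f = g + k` with `F g`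
and `G k` small; up to small errors `F · f` is `F · k` and `G · f` is `G · g`, and after removing `g
⊓ k` the first consequence separates them (`bidualMul_inf_bidualMul_eq_zero`).

Interval preservation. Given `0 ≤ g ≤ F · f`, the functional `f · a ↦ g a` on the range of `S_f` is
dominated by the sublinear map `φ ↦ F φ⁺`, because `f · a⁺ ≤ (f · a)⁺` (`dualMul_posPart_le`).
Hahn-Banach extends it to a functional between `0` and `F`, which is order continuous since such
functionals form an ideal (`exists_bidualMul_eq`).

Restriction to `A`. Here `(a'' · f) b = f (b * a)` while `(f · a) b = f (a * b)`, so commutativity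
is needed. It follows from the estimate `|f (e * b - b * e)| ≤ 4 * f (e * e)`
(`abs_dual_commutator_le`), quadratic in `e` on the right and linear on the left, because positive
functionals separate points. -/

section RieszSpace

/-! ### Disjointness and band preserving operators in Riesz spaces. -/

variable {E : Type u} [AddCommGroup E] [Lattice E] [IsOrderedAddMonoid E]

theorem le_of_le_add_of_inf_eq_zero {a b c : E} (hb : 0 ≤ b) (h : a ≤ b + c) (hac : a ⊓ c = 0) :
    a ≤ b := by
  have h1 : a - b ≤ a ⊓ c := le_inf (sub_le_self _ hb) (sub_le_iff_le_add'.2 h)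
  rw [hac] at h1
  exact sub_nonpos.1 h1

theorem inf_eq_zero_of_le {a b a' b' : E} (h : a ⊓ b = 0) (ha' : 0 ≤ a') (hb' : 0 ≤ b')
    (ha : a' ≤ a) (hb : b' ≤ b) : a' ⊓ b' = 0 :=
  le_antisymm ((inf_le_inf ha hb).trans h.le) (le_inf ha' hb')

theorem posPart_inf_posPart_sub (a b : E) : (a - b)⁺ ⊓ (b - a)⁺ = 0 := by
  rw [← neg_sub a b, posPart_neg]
  exact posPart_inf_negPart_eq_zero _

theorem sub_inf_eq_posPart (a b : E) : a - a ⊓ b = (a - b)⁺ := by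
  rw [posPart_def, sub_inf, sub_self, sup_comm]

variable [Module ℝ E] [PosSMulMono ℝ E]

/-- Both `c • a` and `b` lie below the `c + 1` multiples of `a` and `b`, so their infimum is at most
`(c + 1) • (a ⊓ b)`. -/
theorem smul_inf_eq_zero {a b : E} (h : a ⊓ b = 0) {c : ℝ} (hc : 0 ≤ c) : (c • a) ⊓ b = 0 := by
  have ha : 0 ≤ a := h.ge.trans inf_le_left
  have hb : 0 ≤ b := h.ge.trans inf_le_right
  have hm : (0 : ℝ) < c + 1 := by linarith
  refine le_antisymm ?_ (le_inf (smul_nonneg hc ha) hb)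
  have key : (c + 1)⁻¹ • ((c • a) ⊓ b) ≤ a ⊓ b := by
    have aux : ∀ {x y : E}, x ≤ (c + 1) • y → (c + 1)⁻¹ • x ≤ y := fun {x y} hxy => by
      have := smul_le_smul_of_nonneg_left hxy (inv_nonneg.2 hm.le)
      rwa [smul_smul, inv_mul_cancel₀ hm.ne', one_smul] at this
    refine le_inf (aux (inf_le_left.trans ?_)) (aux (inf_le_right.trans ?_))
    · rw [add_smul, one_smul]
      exact le_add_of_nonneg_right ha
    · rw [add_smul, one_smul]
      exact le_add_of_nonneg_left (smul_nonneg hc hb)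
  rw [h] at key
  have := smul_le_smul_of_nonneg_left key hm.le
  rwa [smul_smul, mul_inv_cancel₀ hm.ne', one_smul, smul_zero] at this

/-- A positive band preserving operator `T` satisfies `c T x ≤ (c² + c) x + T² x` on the positive
cone. -/
theorem smul_le_of_bandPreserving (T : E →ₗ[ℝ] E) (hT : ∀ x, 0 ≤ x → 0 ≤ T x)
    (hband : ∀ x y, x ⊓ y = 0 → T x ⊓ y = 0) {c : ℝ} (hc : 0 ≤ c) {x : E} (hx : 0 ≤ x) :
    c • T x ≤ (c * c + c) • x + T (T x) := by
  have hmono : ∀ {y z : E}, y ≤ z → T y ≤ T z := fun {y z} h => by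
    have := hT _ (sub_nonneg.2 h)
    rwa [map_sub, sub_nonneg] at this
  set v := (T x - c • x)⁺ with hv
  have hv0 : 0 ≤ v := posPart_nonneg _
  have he0 : 0 ≤ x ⊓ v := le_inf hx hv0
  have hvT : v ≤ T x := sup_le (sub_le_self _ (smul_nonneg hc hx)) (hT x hx)
  -- In `T x = T (x ⊓ v) + T (x - v)⁺` the last term is disjoint from `(v - x)⁺` by band
  -- preservation, so it can be dropped from the bound `(v - x)⁺ ≤ T x`.
  have h1 : (v - x)⁺ ≤ T (x ⊓ v) := by
    refine le_of_le_add_of_inf_eq_zero (c := T (x - x ⊓ v)) (hT _ he0) ?_ ?_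
    · rw [← map_add, add_sub_cancel]
      exact sup_le ((sub_le_self _ hx).trans hvT) (hT x hx)
    · rw [sub_inf_eq_posPart, inf_comm]
      exact hband _ _ (posPart_inf_posPart_sub x v)
  -- `c • x` exceeds `T x` by at most `(T x - c • x)⁻`, which is disjoint from `v`.
  have h2 : c • (x ⊓ v) ≤ T x := by
    refine le_of_le_add_of_inf_eq_zero (c := (T x - c • x)⁻) (hT x hx) ?_ ?_
    · refine (smul_le_smul_of_nonneg_left inf_le_left hc).trans ?_
      rw [← sub_le_iff_le_add', ← neg_sub]
      exact neg_le_negPart _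
    · refine smul_inf_eq_zero ?_ hc
      exact inf_eq_zero_of_le (posPart_inf_negPart_eq_zero (T x - c • x)) he0 (negPart_nonneg _)
        inf_le_right le_rfl
  have h3 : c • (v - x)⁺ ≤ T (T x) := by
    refine (smul_le_smul_of_nonneg_left h1 hc).trans ?_
    rw [← map_smul]
    exact hmono h2
  have h4 : T x ≤ c • x + x + (v - x)⁺ := by
    have e1 : T x - c • x ≤ v := le_posPart _
    have e2 : v - x ≤ (v - x)⁺ := le_posPart _
    rw [add_assoc]
    exact sub_le_iff_le_add'.1 (e1.trans (sub_le_iff_le_add'.1 e2))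
  calc c • T x ≤ c • (c • x + x + (v - x)⁺) := smul_le_smul_of_nonneg_left h4 hc
    _ = (c * c + c) • x + c • (v - x)⁺ := by rw [smul_add, smul_add, smul_smul, add_smul]
    _ ≤ _ := add_le_add_right h3 _

/-- A linear map between Riesz spaces that preserves disjointness of positive elements is a lattice
homomorphism. -/
theorem isLatticeHomomorphism_of_inf_eq_zero {F : Type v} [AddCommGroup F] [Lattice F]
    [IsOrderedAddMonoid F] [Module ℝ F] (T : E →ₗ[ℝ] F)
    (hT : ∀ x y, x ⊓ y = 0 → T x ⊓ T y = 0) : IsLatticeHomomorphism T := by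
  have hinf : ∀ x y, T (x ⊓ y) = T x ⊓ T y := by
    intro x y
    have h0 : (x - x ⊓ y) ⊓ (y - x ⊓ y) = 0 := by
      rw [← inf_sub, sub_self]
    have h1 := hT _ _ h0
    rw [map_sub, map_sub, ← inf_sub, sub_eq_zero] at h1
    exact h1.symm
  refine ⟨fun x y => ?_, hinf⟩
  have h1 := congrArg T (inf_add_sup x y)
  rw [map_add, map_add, hinf, ← inf_add_sup (T x) (T y)] at h1
  exact add_left_cancel h1

end RieszSpace

/-! ### Riesz-Kantorovich formulas and the ideal of order continuous functionals. -/

namespace OrdDual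

variable {E : Type u} [AddCommGroup E] [Lattice E] [IsOrderedAddMonoid E] [Module ℝ E]
  [PosSMulMono ℝ E]

theorem inf_apply_le (φ ψ : OrdDual E) {x c : E} (hx : 0 ≤ x) (hxc : x ≤ c) :
    (φ ⊓ ψ) c ≤ φ x + ψ (c - x) := by
  have h1 : (φ ⊓ ψ) x ≤ φ x := (inf_le_left : φ ⊓ ψ ≤ φ) x hx
  have h2 : (φ ⊓ ψ) (c - x) ≤ ψ (c - x) := (inf_le_right : φ ⊓ ψ ≤ ψ) _ (sub_nonneg.2 hxc)
  rw [map_sub] at h2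
  linarith

/-- The value of `φ ⊓ ψ` at `c` is the infimum of `φ x + ψ (c - x)` over `0 ≤ x ≤ c`. A gap `ε`
would force `(φ - ψ)⁺ c ≤ φ c - ε`, whereas disjointness means `(φ - ψ)⁺ = φ`. -/
theorem exists_add_lt_of_inf_eq_zero {φ ψ : OrdDual E} (h : φ ⊓ ψ = 0) {c : E} (hc : 0 ≤ c)
    {ε : ℝ} (hε : 0 < ε) : ∃ x, 0 ≤ x ∧ x ≤ c ∧ φ x + ψ (c - x) < ε := by
  by_contra! hcon
  have h1 : pos (φ - ψ) c ≤ φ c - ε := by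
    refine pos_apply_le _ hc fun y hy hyc => ?_
    have := hcon (c - y) (sub_nonneg.2 hyc) (sub_le_self _ hy)
    rw [sub_sub_cancel, map_sub] at this
    rw [sub_apply]
    linarith
  rw [inf_eq, sub_eq_zero] at h
  rw [← h] at h1
  linarith

theorem nonneg_apply {φ : OrdDual E} (hφ : 0 ≤ φ) {x : E} (hx : 0 ≤ x) : 0 ≤ φ x := hφ x hx

theorem pos_eq_sup (φ : OrdDual E) : pos φ = φ ⊔ 0 := by
  rw [sup_eq, sub_zero, zero_add]

theorem pos_of_nonneg {φ : OrdDual E} (hφ : 0 ≤ φ) : pos φ = φ := by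
  rw [pos_eq_sup, sup_eq_left.2 hφ]

theorem pos_of_nonpos {φ : OrdDual E} (hφ : φ ≤ 0) : pos φ = 0 := by
  rw [pos_eq_sup, sup_eq_right.2 hφ]

theorem le_pos (φ : OrdDual E) : φ ≤ pos φ := fun _ hx => le_pos_apply φ hx le_rfl

theorem pos_add_le (φ ψ : OrdDual E) : pos (φ + ψ) ≤ pos φ + pos ψ := by
  rw [pos_eq_sup (φ + ψ)]
  exact sup_le (add_le_add (le_pos φ) (le_pos ψ)) (add_nonneg (pos_nonneg φ) (pos_nonneg ψ))

theorem pos_smul_le {c : ℝ} (hc : 0 ≤ c) (φ : OrdDual E) : pos (c • φ) ≤ c • pos φ := by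
  rw [pos_eq_sup (c • φ)]
  exact sup_le (smul_le_smul_of_nonneg_left (le_pos φ) hc) (smul_nonneg hc (pos_nonneg φ))

theorem pos_smul {c : ℝ} (hc : 0 < c) (φ : OrdDual E) : pos (c • φ) = c • pos φ := by
  refine le_antisymm (pos_smul_le hc.le φ) ?_
  have h := smul_le_smul_of_nonneg_left (pos_smul_le (inv_nonneg.2 hc.le) (c • φ)) hc.le
  rwa [smul_smul, smul_smul, inv_mul_cancel₀ hc.ne', mul_inv_cancel₀ hc.ne', one_smul,
    one_smul] at h

/-- An order continuous functional is arbitrarily small along a net that decreases to `0`. -/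
theorem exists_apply_lt {φ : OrdDual E} (hφ : φ ∈ orderContinuousFunctionals E) {ι : Type u}
    [Preorder ι] [IsDirectedOrder ι] [Nonempty ι] {y : ι → E} (hy : Antitone y)
    (hy0 : IsGLB (range y) 0) {ε : ℝ} (hε : 0 < ε) : ∃ i, φ (y i) < ε := by
  obtain ⟨z, -, hz0, hyz⟩ := hφ ι y ⟨y, hy, hy0, fun i => by
    rw [sub_zero, abs_of_nonneg (hy0.1 ⟨i, rfl⟩)]⟩
  by_contra! h
  have : ε ≤ 0 := hz0.2 (by
    rintro _ ⟨i, rfl⟩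
    have := hyz i
    rw [sub_zero] at this
    exact (h i).trans ((le_abs_self _).trans this))
  linarith

/-- The order continuous functionals form an ideal of the order dual. -/
theorem mem_orderContinuous_of_le {φ ψ : OrdDual E} (hφ : φ ∈ orderContinuousFunctionals E)
    (h0 : 0 ≤ ψ) (h : ψ ≤ φ) : ψ ∈ orderContinuousFunctionals E := by
  intro ι _ _ _ x hx
  obtain ⟨y, hy, hy0, hxy⟩ := hx
  have hynn : ∀ i, 0 ≤ y i := fun i => hy0.1 ⟨i, rfl⟩
  refine ⟨fun i => φ (y i), fun i j hij => mono (h0.trans h) (hy hij), ⟨?_, ?_⟩, fun i => ?_⟩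
  · rintro _ ⟨i, rfl⟩
    exact (h0.trans h) _ (hynn i)
  · intro c hc
    by_contra! hc0
    obtain ⟨i, hi⟩ := exists_apply_lt hφ hy hy0 hc0
    exact absurd (hc ⟨i, rfl⟩) (not_le.2 hi)
  · have h1 := hxy i
    rw [sub_zero] at h1 ⊢
    refine le_trans ?_ (h _ (hynn i))
    rw [abs_le']
    refine ⟨mono h0 ((le_abs_self _).trans h1), ?_⟩
    rw [← map_neg]
    exact mono h0 ((neg_le_abs _).trans h1)

end OrdDual

/-! ### Inequalities in `f`-algebras, and commutativity. -/

section FAlgebra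

variable {A : Type u} [NonUnitalRing A] [Lattice A] [Module ℝ A] [FAlgebra A]

theorem FAlgebra.mul_le_mul_left' {a x y : A} (ha : 0 ≤ a) (h : x ≤ y) : a * x ≤ a * y := by
  have := FAlgebra.mul_nonneg a (y - x) ha (sub_nonneg.2 h)
  rwa [mul_sub, sub_nonneg] at this

theorem FAlgebra.mul_le_mul_right' {a x y : A} (ha : 0 ≤ a) (h : x ≤ y) : x * a ≤ y * a := by
  have := FAlgebra.mul_nonneg (y - x) a (sub_nonneg.2 h) ha
  rwa [sub_mul, sub_nonneg] at this

/-- Disjoint elements of an `f`-algebra have product `0`. -/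
theorem FAlgebra.mul_eq_zero_of_inf_eq_zero {a b : A} (h : a ⊓ b = 0) : a * b = 0 := by
  have ha : 0 ≤ a := h.ge.trans inf_le_left
  have hb : 0 ≤ b := h.ge.trans inf_le_right
  have h1 := FAlgebra.inf_mul_eq_zero a b b h hb
  rw [inf_comm] at h1
  have h2 := FAlgebra.mul_inf_eq_zero b (a * b) a h1 ha
  rwa [inf_idem] at h2

/-- With `y = (b - c • a)⁺`, disjointness gives `(b - c • a) * y = y * y ≥ 0`, whence `c • (a * y) ≤
b * y ≤ b * b`. Thus `a * y` is of order `1 / c`. -/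
theorem FAlgebra.smul_mul_posPart_le {a b : A} (ha : 0 ≤ a) (hb : 0 ≤ b) {c : ℝ} (hc : 0 ≤ c) :
    c • (a * (b - c • a)⁺) ≤ b * b := by
  set y := (b - c • a)⁺ with hy
  have hyb : y ≤ b := sup_le (sub_le_self _ (smul_nonneg hc ha)) hb
  have h1 : (b - c • a)⁻ * y = 0 := FAlgebra.mul_eq_zero_of_inf_eq_zero (by
    rw [inf_comm]; exact posPart_inf_negPart_eq_zero (b - c • a))
  have h2 : (b - c • a) * y = y * y := by
    conv_lhs => rw [← posPart_sub_negPart (b - c • a), sub_mul, h1, sub_zero]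
  have h3 : 0 ≤ (b - c • a) * y :=
    h2 ▸ FAlgebra.mul_nonneg y y (posPart_nonneg _) (posPart_nonneg _)
  rw [sub_mul, sub_nonneg, smul_mul_assoc] at h3
  exact h3.trans (FAlgebra.mul_le_mul_left' hb hyb)

theorem FAlgebra.smul_posPart_mul_le {a b : A} (ha : 0 ≤ a) (hb : 0 ≤ b) {c : ℝ} (hc : 0 ≤ c) :
    c • ((b - c • a)⁺ * a) ≤ b * b := by
  set y := (b - c • a)⁺ with hy
  have hyb : y ≤ b := sup_le (sub_le_self _ (smul_nonneg hc ha)) hb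
  have h1 : y * (b - c • a)⁻ = 0 :=
    FAlgebra.mul_eq_zero_of_inf_eq_zero (posPart_inf_negPart_eq_zero (b - c • a))
  have h2 : y * (b - c • a) = y * y := by
    conv_lhs => rw [← posPart_sub_negPart (b - c • a), mul_sub, h1, sub_zero]
  have h3 : 0 ≤ y * (b - c • a) :=
    h2 ▸ FAlgebra.mul_nonneg y y (posPart_nonneg _) (posPart_nonneg _)
  rw [mul_sub, sub_nonneg, mul_smul_comm] at h3
  exact h3.trans (FAlgebra.mul_le_mul_right' hb hyb)

theorem posPart_posPart_sub {x e : A} (he : 0 ≤ e) : (x⁺ - e)⁺ = (x - e)⁺ := by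
  rw [posPart_def x, posPart_def, posPart_def, sup_sub, zero_sub, sup_assoc,
    sup_eq_right.2 (neg_nonpos.2 he)]

/-- Each slice of `b` of thickness `e` commutes with `e` up to a telescoping error, and the
remainder `(b - k • e)⁺` contributes `O(1 / k)`. The total error therefore does not depend on the
number of slices. -/
theorem abs_dual_commutator_le {f : OrdDual A} (hf : 0 ≤ f) {e b : A} (he : 0 ≤ e) (hb : 0 ≤ b) :
    |f (e * b - b * e)| ≤ 4 * f (e * e) := by
  -- `b` is cut into the slices `t k ⊓ e = t k - t (k + 1)`
  let t : ℕ → A := fun k => (b - (k : ℝ) • e)⁺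
  have ht0 : ∀ k, 0 ≤ t k := fun k => posPart_nonneg _
  have htz : t 0 = b := by simp [t, posPart_eq_self.2 hb]
  have hts : ∀ k, t (k + 1) = (t k - e)⁺ := fun k => by
    change (b - ((k + 1 : ℕ) : ℝ) • e)⁺ = ((b - (k : ℝ) • e)⁺ - e)⁺
    rw [posPart_posPart_sub he, Nat.cast_succ, add_smul, one_smul, sub_sub]
  let s : ℕ → A := fun k => t k ⊓ e
  have hs0 : ∀ k, 0 ≤ s k := fun k => le_inf (ht0 k) he
  have hse : ∀ k, s k ≤ e := fun k => inf_le_right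
  have hst : ∀ k, s k = t k - t (k + 1) := fun k => by
    rw [hts, ← sub_inf_eq_posPart, sub_sub_cancel]
  have hsa : ∀ k, s (k + 1) ≤ s k := fun k =>
    inf_le_inf_right _ (by rw [hts]; exact sup_le (sub_le_self _ he) (ht0 k))
  -- The next slice lives only where the current one is full: `e - s k = (e - t k)⁺` and `s (k + 1)
  -- ≤ (t k - e)⁺`.
  have hdisj : ∀ k, (e - s k) ⊓ s (k + 1) = 0 := fun k => by
    refine inf_eq_zero_of_le (posPart_inf_posPart_sub e (t k)) (sub_nonneg.2 (hse k)) (hs0 _) ?_ ?_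
    · rw [← sub_inf_eq_posPart, inf_comm]
    · rw [← hts]
      exact inf_le_left
  have hfm : ∀ {x y : A}, 0 ≤ x → 0 ≤ y → 0 ≤ f (x * y) := fun hx hy =>
    hf _ (FAlgebra.mul_nonneg _ _ hx hy)
  have hcomm : ∀ {x y : A}, 0 ≤ x → 0 ≤ y → y ≤ e →
      |f (x * y - y * x)| ≤ f (x * e) + f (e * x) := fun {x y} hx hy hye => by
    have e1 := hfm hx hy
    have e2 := hfm hy hx
    have e3 := OrdDual.mono hf (FAlgebra.mul_le_mul_left' hx hye)
    have e4 := OrdDual.mono hf (FAlgebra.mul_le_mul_right' hx hye)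
    rw [map_sub, abs_le]
    constructor <;> linarith
  -- By disjointness `e` may be replaced by `s k` in both products with `s (k + 1)`, so the
  -- commutator equals that of `s k - s (k + 1)` with `s (k + 1)`; the resulting bound is a
  -- difference of consecutive terms.
  have hslice : ∀ k, |f (e * s (k + 1) - s (k + 1) * e)| ≤
      f (s k * e) + f (e * s k) - (f (s (k + 1) * e) + f (e * s (k + 1))) := fun k => by
    have e1 := FAlgebra.mul_eq_zero_of_inf_eq_zero (hdisj k)
    have e2 := FAlgebra.mul_eq_zero_of_inf_eq_zero ((inf_comm _ _).trans (hdisj k))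
    rw [sub_mul, sub_eq_zero] at e1
    rw [mul_sub, sub_eq_zero] at e2
    have e3 := hcomm (sub_nonneg.2 (hsa k)) (hs0 (k + 1)) (hse (k + 1))
    have e4 : (s k - s (k + 1)) * s (k + 1) - s (k + 1) * (s k - s (k + 1)) =
        e * s (k + 1) - s (k + 1) * e := by
      rw [e1, e2, sub_mul, mul_sub]
      abel
    rw [e4, sub_mul, mul_sub, map_sub f.toLin (s k * e), map_sub f.toLin (e * s k)] at e3
    linarith
  -- `b - t (k + 1)` is the sum of the slices `s 0, ..., s k`. The term `2 * f (e * e)` bounds the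
  -- crude error of slice `0`; since `s 0 ≤ e`, the telescoped part adds at most another `2 * f (e *
  -- e)`.
  have hsum : ∀ k, |f (e * (b - t (k + 1)) - (b - t (k + 1)) * e)| ≤
      2 * f (e * e) + (f (s 0 * e) + f (e * s 0)) - (f (s k * e) + f (e * s k)) := fun k => by
    induction k with
    | zero =>
      have e1 : b - t (0 + 1) = s 0 := by rw [hst, htz]
      rw [e1]
      have := hcomm he (hs0 0) (hse 0)
      linarith
    | succ k ih =>
      have e1 : e * (b - t (k + 1 + 1)) - (b - t (k + 1 + 1)) * e =
          (e * (b - t (k + 1)) - (b - t (k + 1)) * e) + (e * s (k + 1) - s (k + 1) * e) := by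
        rw [hst (k + 1)]
        simp only [mul_sub, sub_mul]
        abel
      rw [e1, map_add]
      have := abs_add_le (f (e * (b - t (k + 1)) - (b - t (k + 1)) * e))
        (f (e * s (k + 1) - s (k + 1) * e))
      have := hslice k
      linarith
  have key : ∀ k : ℕ, ((k + 1 : ℕ) : ℝ) * (|f (e * b - b * e)| - 4 * f (e * e)) ≤
      2 * f (b * b) := fun k => by
    have hk : (0 : ℝ) ≤ ((k + 1 : ℕ) : ℝ) := Nat.cast_nonneg _
    have e1 := OrdDual.mono hf (FAlgebra.smul_mul_posPart_le he hb hk)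
    have e2 := OrdDual.mono hf (FAlgebra.smul_posPart_mul_le he hb hk)
    rw [map_smul, smul_eq_mul] at e1 e2
    change _ * f (e * t (k + 1)) ≤ _ at e1
    change _ * f (t (k + 1) * e) ≤ _ at e2
    have e3 := hsum k
    have e4 : e * b - b * e = (e * (b - t (k + 1)) - (b - t (k + 1)) * e) +
        (e * t (k + 1) - t (k + 1) * e) := by
      simp only [mul_sub, sub_mul]
      abel
    have e5 : |f (e * t (k + 1) - t (k + 1) * e)| ≤ f (e * t (k + 1)) + f (t (k + 1) * e) := by
      have h1 := hfm he (ht0 (k + 1))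
      have h2 := hfm (ht0 (k + 1)) he
      rw [map_sub, abs_le]
      constructor <;> linarith
    have e6 := abs_add_le (f (e * (b - t (k + 1)) - (b - t (k + 1)) * e))
      (f (e * t (k + 1) - t (k + 1) * e))
    rw [← map_add, ← e4] at e6
    have e7 := OrdDual.mono hf (FAlgebra.mul_le_mul_right' he (hse 0))
    have e8 := OrdDual.mono hf (FAlgebra.mul_le_mul_left' he (hse 0))
    have e9 := hfm (hs0 k) he
    have e10 := hfm he (hs0 k)
    have e11 : |f (e * b - b * e)| - 4 * f (e * e) ≤ f (e * t (k + 1)) + f (t (k + 1) * e) := by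
      linarith
    have := mul_le_mul_of_nonneg_left e11 hk
    linarith
  by_contra! hcon
  obtain ⟨n, hn⟩ := exists_nat_gt (2 * f (b * b) / (|f (e * b - b * e)| - 4 * f (e * e)))
  rw [div_lt_iff₀ (sub_pos.2 hcon)] at hn
  have h1 := key n
  rw [Nat.cast_succ] at h1
  linarith

/-- Positive functionals on an `f`-algebra do not distinguish `a * b` from `b * a`. -/
theorem dual_mul_comm_of_nonneg {f : OrdDual A} (hf : 0 ≤ f) {a b : A} (ha : 0 ≤ a) (hb : 0 ≤ b) :
    f (a * b) = f (b * a) := by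
  -- The commutator estimate is applied with `e = a / (n + 1)` and multiplied by `(n + 1)²`.
  have key : ∀ n : ℕ, ((n + 1 : ℕ) : ℝ) * |f (a * b - b * a)| ≤ 4 * f (a * a) := fun n => by
    have hn : (0 : ℝ) < ((n + 1 : ℕ) : ℝ) := by positivity
    have h := abs_dual_commutator_le hf (smul_nonneg (inv_nonneg.2 hn.le) ha) hb
    rw [smul_mul_assoc, mul_smul_comm, ← smul_sub, map_smul, smul_mul_smul_comm, map_smul,
      smul_eq_mul, smul_eq_mul, abs_mul, abs_of_pos (inv_pos.2 hn)] at h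
    have h' := mul_le_mul_of_nonneg_left h (mul_nonneg hn.le hn.le)
    field_simp at h'
    linarith
  have h0 : |f (a * b - b * a)| ≤ 0 := by
    by_contra! hcon
    obtain ⟨n, hn⟩ := exists_nat_gt (4 * f (a * a) / |f (a * b - b * a)|)
    rw [div_lt_iff₀ hcon] at hn
    have h1 := key n
    rw [Nat.cast_succ] at h1
    linarith
  rw [abs_nonpos_iff, map_sub, sub_eq_zero] at h0
  exact h0

/-- An `f`-algebra whose order dual separates points is commutative. -/
theorem FAlgebra.mul_comm_of_separating (hA : HasSeparatingOrderDual A) (a b : A) :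
    a * b = b * a := by
  have h1 : ∀ {x y : A}, 0 ≤ x → 0 ≤ y → x * y = y * x := fun {x y} hx hy => by
    refine sub_eq_zero.1 (hA _ fun φ => ?_)
    have hφ : φ = φ⁺ - φ⁻ := (posPart_sub_negPart φ).symm
    rw [hφ, OrdDual.sub_apply, map_sub, map_sub,
      dual_mul_comm_of_nonneg (posPart_nonneg φ) hx hy,
      dual_mul_comm_of_nonneg (negPart_nonneg φ) hx hy, sub_self, sub_self, sub_self]
  rw [← posPart_sub_negPart a, ← posPart_sub_negPart b]
  simp only [mul_sub, sub_mul]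
  rw [h1 (posPart_nonneg a) (posPart_nonneg b), h1 (negPart_nonneg a) (posPart_nonneg b),
    h1 (posPart_nonneg a) (negPart_nonneg b), h1 (negPart_nonneg a) (negPart_nonneg b)]
  abel

/-- For fixed `c` the first term on the right vanishes as `p x` tends to `0`; dividing by a large
`c` then controls `p (a * x)`. Left multiplication is used for `F · d`, its right-handed twin for
the net `p · z n`. -/
theorem mul_dual_le {p : OrdDual A} (hp : 0 ≤ p) {a x : A} (ha : 0 ≤ a) (hx : 0 ≤ x) {c : ℝ}
    (hc : 0 ≤ c) : c * p (a * x) ≤ (c * c + c) * p x + p (a * (a * x)) := by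
  have h := OrdDual.mono hp (smul_le_of_bandPreserving (LinearMap.mulLeft ℝ a)
    (fun y hy => FAlgebra.mul_nonneg a y ha hy)
    (fun y z h => FAlgebra.mul_inf_eq_zero y z a h ha) hc hx)
  simpa using h

theorem dual_mul_le {p : OrdDual A} (hp : 0 ≤ p) {b x : A} (hb : 0 ≤ b) (hx : 0 ≤ x) {c : ℝ}
    (hc : 0 ≤ c) : c * p (x * b) ≤ (c * c + c) * p x + p (x * b * b) := by
  have h := OrdDual.mono hp (smul_le_of_bandPreserving (LinearMap.mulRight ℝ b)
    (fun y hy => FAlgebra.mul_nonneg y b hy hb)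
    (fun y z h => FAlgebra.inf_mul_eq_zero y z b h hb) hc hx)
  simpa using h

/-! ### The products `f · a` and `F · f`: positivity and positive parts. -/

theorem dualMul_mono_right {f : OrdDual A} (hf : 0 ≤ f) {a b : A} (h : a ≤ b) :
    dualMul f a ≤ dualMul f b := fun _ hx => OrdDual.mono hf (FAlgebra.mul_le_mul_right' hx h)

theorem dualMul_nonneg {f : OrdDual A} (hf : 0 ≤ f) {a : A} (ha : 0 ≤ a) : 0 ≤ dualMul f a :=
  fun x hx => hf _ (FAlgebra.mul_nonneg a x ha hx)

theorem bidualMul_nonneg {F : OrdContDual (OrdDual A)} (hF : 0 ≤ F) {f : OrdDual A} (hf : 0 ≤ f) :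
    0 ≤ bidualMul F f := fun _ ha => hF _ (dualMul_nonneg hf ha)

theorem bidualMul_add (F : OrdContDual (OrdDual A)) (f g : OrdDual A) (a : A) :
    bidualMul F (f + g) a = bidualMul F f a + bidualMul F g a :=
  map_add (OrdContDual.incl _ F).toLin (dualMul f a) (dualMul g a)

/-- The operator `a ↦ f · a` commutes with positive parts: the nontrivial inequality. -/
theorem dualMul_posPart_le {f : OrdDual A} (hf : 0 ≤ f) (a : A) :
    dualMul f a⁺ ≤ OrdDual.pos (dualMul f a) := by
  intro c hc
  have key : ∀ n : ℕ, (n : ℝ) * (dualMul f a⁺ c - OrdDual.pos (dualMul f a) c) ≤ f (c * c) := by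
    intro n
    have hn : (0 : ℝ) ≤ n := n.cast_nonneg
    -- An almost optimal element for the supremum defining `(f · a)⁺ c`: the part `c ⊓ n • a⁻`
    -- removed from `c` is disjoint from `a⁺`, so `a⁺ * y = a⁺ * c`, while `a⁻ * y` is of order `1 /
    -- n`.
    set y := (c - (n : ℝ) • a⁻)⁺ with hy
    have hy0 : 0 ≤ y := posPart_nonneg _
    have hyc : y ≤ c := sup_le (sub_le_self _ (smul_nonneg hn (negPart_nonneg a))) hc
    have h1 : a⁺ * y = a⁺ * c := by
      have e1 : c - y = c ⊓ ((n : ℝ) • a⁻) := by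
        rw [hy, ← sub_inf_eq_posPart, sub_sub_cancel]
      have e2 : a⁺ * (c - y) = 0 := by
        refine FAlgebra.mul_eq_zero_of_inf_eq_zero (inf_eq_zero_of_le
          (b := (n : ℝ) • a⁻) ?_ (posPart_nonneg a) (sub_nonneg.2 hyc) le_rfl ?_)
        · rw [inf_comm]
          exact smul_inf_eq_zero (by rw [inf_comm]; exact posPart_inf_negPart_eq_zero a) hn
        · rw [e1]
          exact inf_le_right
      rw [mul_sub, sub_eq_zero] at e2
      exact e2.symm
    have h2 : (n : ℝ) • (a⁻ * y) ≤ c * c :=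
      FAlgebra.smul_mul_posPart_le (negPart_nonneg a) hc hn
    have h3 := OrdDual.le_pos_apply (dualMul f a) hy0 hyc
    have h4 : dualMul f a y = f (a⁺ * c) - f (a⁻ * y) := by
      rw [dualMul_apply, ← h1, ← map_sub, ← sub_mul, posPart_sub_negPart]
    have h5 := OrdDual.mono hf h2
    rw [map_smul, smul_eq_mul] at h5
    rw [dualMul_apply]
    refine le_trans (mul_le_mul_of_nonneg_left (b := _) (c := f (a⁻ * y)) ?_ hn) h5
    linarith
  by_contra! hcon
  obtain ⟨n, hn⟩ := exists_nat_gt (f (c * c) / (dualMul f a⁺ c - OrdDual.pos (dualMul f a) c))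
  rw [div_lt_iff₀ (sub_pos.2 hcon)] at hn
  exact absurd (key n) (not_le.2 hn)

/-! ### Preservation of disjointness. -/

/-- For positive `F` and disjoint `p`, `q`, also `F · p` and `q` are disjoint. -/
theorem bidualMul_inf_eq_zero {F : OrdContDual (OrdDual A)} (hF : 0 ≤ F) {p q : OrdDual A}
    (h : p ⊓ q = 0) : bidualMul F p ⊓ q = 0 := by
  have hp : 0 ≤ p := h.ge.trans inf_le_left
  have hq : 0 ≤ q := h.ge.trans inf_le_right
  refine le_antisymm (fun c hc => ?_) (le_inf (bidualMul_nonneg hF hp) hq)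
  rw [OrdDual.zero_apply]
  refine le_of_forall_pos_le_add fun ε hε => ?_
  -- The bounds are summable, so that passing to running infima costs at most `ε / 2` in `q`, since
  -- `c - z n` is below the sum of the `c - x k`, while `p (z n)` still tends to `0`.
  have hx : ∀ n : ℕ, ∃ x, 0 ≤ x ∧ x ≤ c ∧ p x + q (c - x) < ε / 2 * (1 / 2) ^ (n + 1) := fun n =>
    OrdDual.exists_add_lt_of_inf_eq_zero h hc (by positivity)
  choose x hx0 hxc hx using hx
  have hpx : ∀ n, p (x n) < ε / 2 * (1 / 2) ^ (n + 1) := fun n => by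
    have := OrdDual.nonneg_apply hq (sub_nonneg.2 (hxc n))
    linarith [hx n]
  have hqx : ∀ n, q (c - x n) < ε / 2 * (1 / 2) ^ (n + 1) := fun n => by
    have := OrdDual.nonneg_apply hp (hx0 n)
    linarith [hx n]
  -- the running infima of `x`
  let z : ℕ → A := fun n => Nat.rec (x 0) (fun k w => w ⊓ x (k + 1)) n
  have hzs : ∀ n, z (n + 1) = z n ⊓ x (n + 1) := fun n => rfl
  have hz0 : ∀ n, 0 ≤ z n := fun n => by
    induction n with
    | zero => exact hx0 0
    | succ k ih => exact le_inf ih (hx0 _)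
  have hzx : ∀ n, z n ≤ x n := fun n => by
    cases n with
    | zero => exact le_rfl
    | succ k => exact inf_le_right
  have hzanti : Antitone z := antitone_nat_of_succ_le fun n => inf_le_left
  have hzc : ∀ n, z n ≤ c := fun n => (hzx n).trans (hxc n)
  have hqz : ∀ n, q (c - z n) ≤ ε / 2 * (1 - (1 / 2) ^ (n + 1)) := fun n => by
    induction n with
    | zero => exact (hqx 0).le.trans (by norm_num)
    | succ k ih =>
      have e1 : c - z (k + 1) ≤ (c - z k) + (c - x (k + 1)) := by
        rw [hzs, sub_inf]
        exact sup_le (le_add_of_nonneg_right (sub_nonneg.2 (hxc _)))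
          (le_add_of_nonneg_left (sub_nonneg.2 (hzc _)))
      have e2 := OrdDual.mono hq e1
      rw [map_add] at e2
      have e3 := hqx (k + 1)
      have e4 : ((1 : ℝ) / 2) ^ (k + 1) = 2 * (1 / 2) ^ (k + 1 + 1) := by
        rw [pow_succ _ (k + 1)]; ring
      rw [e4] at ih
      linarith
  -- `ULift` places the index set in the universe over which order continuity quantifies.
  have hanti : Antitone fun i : ULift.{u} ℕ => dualMul p (z i.down) := fun i j hij =>
    dualMul_mono_right hp (hzanti hij)
  have hglb : IsGLB (range fun i : ULift.{u} ℕ => dualMul p (z i.down)) 0 := by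
    refine ⟨by rintro _ ⟨i, rfl⟩; exact dualMul_nonneg hp (hz0 _), fun ψ hψ b hb => ?_⟩
    rw [OrdDual.zero_apply]
    have hψ' : ∀ n, ψ b ≤ p (z n * b) := fun n => hψ ⟨⟨n⟩, rfl⟩ b hb
    -- For fixed `N` the term `(N² + N) * p (z n)` vanishes as `n → ∞`, leaving a bound independent
    -- of `N`; the Archimedean property then yields `ψ b ≤ 0`.
    have e1 : ∀ N : ℕ, (N : ℝ) * ψ b ≤ p (c * b * b) := fun N => by
      have hN : (0 : ℝ) ≤ N := N.cast_nonneg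
      have hlim : Tendsto (fun n : ℕ => ((N : ℝ) * N + N) * (ε / 2 * (1 / 2) ^ (n + 1))
          + p (c * b * b)) atTop (𝓝 (((N : ℝ) * N + N) * (ε / 2 * 0) + p (c * b * b))) :=
        ((((tendsto_pow_atTop_nhds_zero_of_lt_one (by norm_num) (by norm_num)).comp
          (tendsto_add_atTop_nat 1)).const_mul _).const_mul _).add_const _
      rw [mul_zero, mul_zero, zero_add] at hlim
      refine ge_of_tendsto' hlim fun n => ?_
      have f1 := mul_le_mul_of_nonneg_left (hψ' n) hN
      have f2 := dual_mul_le hp hb (hz0 n) hN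
      have f3 : p (z n * b * b) ≤ p (c * b * b) := OrdDual.mono hp
        (FAlgebra.mul_le_mul_right' hb (FAlgebra.mul_le_mul_right' hb (hzc n)))
      have f4 : p (z n) ≤ ε / 2 * (1 / 2) ^ (n + 1) :=
        (OrdDual.mono hp (hzx n)).trans (hpx n).le
      have f5 := mul_le_mul_of_nonneg_left f4 (by positivity : (0 : ℝ) ≤ (N : ℝ) * N + N)
      linarith
    by_contra! hcon
    obtain ⟨N, hN⟩ := exists_nat_gt (p (c * b * b) / ψ b)
    rw [div_lt_iff₀ hcon] at hN
    exact absurd (e1 N) (not_le.2 hN)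
  obtain ⟨⟨n⟩, hn⟩ := OrdDual.exists_apply_lt F.2 hanti hglb (half_pos hε)
  have h1 := OrdDual.inf_apply_le (bidualMul F p) q (hz0 n) (hzc n)
  have h2 : bidualMul F p (z n) < ε / 2 := hn
  have h3 := hqz n
  have h4 : 0 ≤ ε / 2 * (1 / 2) ^ (n + 1) := by positivity
  linarith

/-- If `d ≤ f` and `F d` is small then `F · d` is small on `[0, a]`. -/
theorem mul_bidualMul_le {F : OrdContDual (OrdDual A)} (hF : 0 ≤ F) {f d : OrdDual A}
    (hd : 0 ≤ d) (hdf : d ≤ f) {a x : A} (hx : 0 ≤ x) (hxa : x ≤ a) {c : ℝ} (hc : 0 ≤ c) :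
    c * bidualMul F d x ≤ (c * c + c) * OrdContDual.incl _ F d + bidualMul F f (a * a) := by
  have ha : 0 ≤ a := hx.trans hxa
  have h1 : c • dualMul d a ≤ (c * c + c) • d + dualMul f (a * a) := fun y hy => by
    have e1 := mul_dual_le hd ha hy hc
    have e2 := hdf _ (FAlgebra.mul_nonneg a _ ha (FAlgebra.mul_nonneg a y ha hy))
    rw [OrdDual.smul_apply, OrdDual.add_apply, OrdDual.smul_apply, dualMul_apply, dualMul_apply,
      mul_assoc]
    linarith
  have hF' : 0 ≤ OrdContDual.incl _ F := hF
  have h2 := OrdDual.mono hF' h1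
  rw [map_smul, map_add, map_smul, smul_eq_mul, smul_eq_mul] at h2
  have h3 : bidualMul F d x ≤ bidualMul F d a := OrdDual.mono (bidualMul_nonneg hF hd) hxa
  exact (mul_le_mul_of_nonneg_left h3 hc).trans h2

/-- For positive `f`, the map `F ↦ F · f` preserves disjointness. -/
theorem bidualMul_inf_bidualMul_eq_zero {f : OrdDual A} (hf : 0 ≤ f)
    {F G : OrdContDual (OrdDual A)} (h : F ⊓ G = 0) : bidualMul F f ⊓ bidualMul G f = 0 := by
  have hF : 0 ≤ F := h.ge.trans inf_le_left
  have hG : 0 ≤ G := h.ge.trans inf_le_right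
  have h' : OrdContDual.incl _ F ⊓ OrdContDual.incl _ G = 0 := congrArg (OrdContDual.incl _) h
  have hF' : 0 ≤ OrdContDual.incl _ F := hF
  have hG' : 0 ≤ OrdContDual.incl _ G := hG
  refine le_antisymm (fun a ha => ?_) (le_inf (bidualMul_nonneg hF hf) (bidualMul_nonneg hG hf))
  rw [OrdDual.zero_apply]
  -- Five error terms of size at most `1` arise: one from the disjoint pair and four from
  -- `mul_bidualMul_le`. Each of these four also contributes a value at `a * a`, two for `F` and two
  -- for `G`.
  have key : ∀ n : ℕ, (n : ℝ) * (bidualMul F f ⊓ bidualMul G f) a ≤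
      5 + 2 * bidualMul F f (a * a) + 2 * bidualMul G f (a * a) := by
    intro n
    have hn : (0 : ℝ) ≤ n := n.cast_nonneg
    have hN : (0 : ℝ) < (n : ℝ) * n + n + 1 := by positivity
    obtain ⟨g, hg0, hgf, hg⟩ := OrdDual.exists_add_lt_of_inf_eq_zero h' hf (inv_pos.2 hN)
    set k := f - g with hk
    have hk0 : 0 ≤ k := sub_nonneg.2 hgf
    have hkf : k ≤ f := sub_le_self _ hg0
    have hd0 : 0 ≤ g ⊓ k := le_inf hg0 hk0
    -- `g` and `k` need not be disjoint, but their common part `g ⊓ k` is small for `F` (being below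
    -- `g`) and for `G` (being below `k`), so it may be removed.
    have hdisj : (k - g ⊓ k) ⊓ (g - g ⊓ k) = 0 := by rw [← inf_sub, inf_comm k g, sub_self]
    have hdisj' : bidualMul F (k - g ⊓ k) ⊓ bidualMul G (g - g ⊓ k) = 0 := by
      have e := bidualMul_inf_eq_zero hF hdisj
      rw [inf_comm] at e ⊢
      exact bidualMul_inf_eq_zero hG e
    obtain ⟨x, hx0, hxa, hx⟩ := OrdDual.exists_add_lt_of_inf_eq_zero hdisj' ha (inv_pos.2 hN)
    have hy0 : 0 ≤ a - x := sub_nonneg.2 hxa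
    have hya : a - x ≤ a := sub_le_self _ hx0
    have small : ∀ t : ℝ, t ≤ ((n : ℝ) * n + n + 1)⁻¹ → ((n : ℝ) * n + n) * t ≤ 1 := fun t ht => by
      refine (mul_le_mul_of_nonneg_left ht (by positivity)).trans ?_
      rw [← div_eq_mul_inv, div_le_one hN]
      linarith
    have hFg : OrdContDual.incl _ F g ≤ ((n : ℝ) * n + n + 1)⁻¹ := by
      have := OrdDual.nonneg_apply hG' hk0
      linarith
    have hGk : OrdContDual.incl _ G k ≤ ((n : ℝ) * n + n + 1)⁻¹ := by
      have := OrdDual.nonneg_apply hF' hg0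
      linarith
    have hFd : OrdContDual.incl _ F (g ⊓ k) ≤ ((n : ℝ) * n + n + 1)⁻¹ :=
      (OrdDual.mono hF' inf_le_left).trans hFg
    have hGd : OrdContDual.incl _ G (g ⊓ k) ≤ ((n : ℝ) * n + n + 1)⁻¹ :=
      (OrdDual.mono hG' inf_le_right).trans hGk
    have e1 := mul_bidualMul_le hF hg0 hgf hx0 hxa hn
    have e2 := mul_bidualMul_le hF hd0 (inf_le_left.trans hgf) hx0 hxa hn
    have e3 := mul_bidualMul_le hG hk0 hkf hy0 hya hn
    have e4 := mul_bidualMul_le hG hd0 (inf_le_left.trans hgf) hy0 hya hn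
    have e5 : bidualMul F f x =
        bidualMul F (k - g ⊓ k) x + bidualMul F (g ⊓ k) x + bidualMul F g x := by
      rw [← bidualMul_add, ← bidualMul_add, sub_add_cancel, hk, sub_add_cancel]
    have e6 : bidualMul G f (a - x) =
        bidualMul G (g - g ⊓ k) (a - x) + bidualMul G (g ⊓ k) (a - x) + bidualMul G k (a - x) := by
      rw [← bidualMul_add, ← bidualMul_add, sub_add_cancel, hk, add_sub_cancel]
    have e7 := mul_le_mul_of_nonneg_left
      (OrdDual.inf_apply_le (bidualMul F f) (bidualMul G f) hx0 hxa) hn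
    have e8 : (n : ℝ) * (bidualMul F (k - g ⊓ k) x + bidualMul G (g - g ⊓ k) (a - x)) ≤ 1 := by
      refine (mul_le_mul_of_nonneg_left hx.le hn).trans ?_
      rw [← div_eq_mul_inv, div_le_one hN]
      nlinarith
    rw [e5, e6] at e7
    have := small _ hFg
    have := small _ hGk
    have := small _ hFd
    have := small _ hGd
    linarith
  by_contra! hcon
  obtain ⟨n, hn⟩ := exists_nat_gt ((5 + 2 * bidualMul F f (a * a) + 2 * bidualMul G f (a * a)) /
    (bidualMul F f ⊓ bidualMul G f) a)
  rw [div_lt_iff₀ hcon] at hn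
  exact absurd (key n) (not_le.2 hn)

/-! ### Interval preservation by Hahn-Banach. -/

/-- Every functional in `[0, F · f]` is of the form `G · f` with `0 ≤ G ≤ F`. -/
theorem exists_bidualMul_eq {f : OrdDual A} (hf : 0 ≤ f) {F : OrdContDual (OrdDual A)} (hF : 0 ≤ F)
    {g : OrdDual A} (hg0 : 0 ≤ g) (hg : g ≤ bidualMul F f) :
    ∃ G : OrdContDual (OrdDual A), 0 ≤ G ∧ G ≤ F ∧ bidualMul G f = g := by
  set Φ : OrdDual (OrdDual A) := OrdContDual.incl _ F with hΦ
  have hΦ0 : 0 ≤ Φ := hF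
  have hdom : ∀ a : A, g a ≤ Φ (OrdDual.pos (dualMul f a)) := fun a =>
    (OrdDual.mono hg0 (le_posPart a)).trans ((hg _ (posPart_nonneg a)).trans
      (OrdDual.mono hΦ0 (dualMul_posPart_le hf a)))
  -- This makes `f · a ↦ g a` well defined on the range, hence independent of the linear section `s`
  -- chosen below.
  have hker : ∀ a : A, dualMulMap f a = 0 → g a = 0 := by
    have aux : ∀ a : A, dualMulMap f a = 0 → g a ≤ 0 := fun a h => by
      have h' : dualMul f a = 0 := h
      have := hdom a
      rwa [h', OrdDual.pos_of_nonneg le_rfl, map_zero] at this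
    intro a h
    refine le_antisymm (aux a h) ?_
    have := aux (-a) (by rw [map_neg, h, neg_zero])
    rw [map_neg] at this
    linarith
  obtain ⟨s, hs⟩ := (dualMulMap f).rangeRestrict.exists_rightInverse_of_surjective
    (LinearMap.range_rangeRestrict _)
  have hs' : ∀ y : LinearMap.range (dualMulMap f), dualMulMap f (s y) = y := fun y =>
    congrArg Subtype.val (LinearMap.congr_fun hs y)
  obtain ⟨l, hl, hlN⟩ := exists_extension_of_le_sublinear
    (⟨LinearMap.range (dualMulMap f), g.toLin ∘ₗ s⟩ : OrdDual A →ₗ.[ℝ] ℝ)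
    (fun φ => Φ (OrdDual.pos φ))
    (fun c hc φ => by rw [OrdDual.pos_smul hc, map_smul, smul_eq_mul])
    (fun φ ψ => by
      rw [← map_add]
      exact OrdDual.mono hΦ0 (OrdDual.pos_add_le φ ψ))
    (fun y => by
      have := hdom (s y)
      have h' : dualMul f (s y) = y := hs' y
      rwa [h'] at this)
  -- Domination at `-φ`, where the positive part vanishes, gives positivity; domination at `φ ≥ 0`
  -- later gives `l ≤ Φ`.
  have hl0 : ∀ φ : OrdDual A, 0 ≤ φ → 0 ≤ l φ := fun φ hφ => by
    have := hlN (-φ)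
    rw [OrdDual.pos_of_nonpos (neg_nonpos.2 hφ), map_zero, map_neg] at this
    linarith
  let Ψ : OrdDual (OrdDual A) := OrdDual.mk l (OrdDual.isOrderBounded_of_nonneg l hl0)
  have hΨ0 : 0 ≤ Ψ := hl0
  have hΨΦ : Ψ ≤ Φ := fun φ hφ => by
    have := hlN φ
    rwa [OrdDual.pos_of_nonneg hφ] at this
  refine ⟨⟨Ψ, OrdDual.mem_orderContinuous_of_le F.2 hΨ0 hΨΦ⟩, hΨ0, hΨΦ,
    OrdDual.ext_nonneg fun a _ => ?_⟩
  change l (dualMulMap f a) = g a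
  have h1 := hl ⟨dualMulMap f a, a, rfl⟩
  rw [h1]
  change g (s ⟨dualMulMap f a, a, rfl⟩) = g a
  rw [← sub_eq_zero, ← map_sub]
  exact hker _ (by rw [map_sub, hs', sub_self])

end FAlgebra

/-! ### The theorem. -/

theorem theorem2p1 {A : Type u} [NonUnitalRing A] [Lattice A] [Module ℝ A] [FAlgebra A]
    (hA : HasSeparatingOrderDual A) (f : OrdDual A) (hf : 0 ≤ f) :
    IsIntervalPreserving (bidualMulMap f) ∧
    IsLatticeHomomorphism (bidualMulMap f) ∧
    (∀ a : A, bidualMulMap f (canonicalEmbedding a) = dualMulMap f a) ∧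
    IsOrderBounded (dualMulMap f) ∧
    (∀ (hS : IsOrderBounded (dualMulMap f)) (F : OrdContDual (OrdDual A)),
      bidualMulMap f F = orderAdjoint (dualMulMap f) hS (OrdContDual.incl _ F)) := by
  refine ⟨⟨fun F hF => bidualMul_nonneg hF hf, fun F hF => ?_⟩,
    isLatticeHomomorphism_of_inf_eq_zero _ fun F G h => bidualMul_inf_bidualMul_eq_zero hf h,
    fun a => OrdDual.ext_nonneg fun b _ => ?_, isOrderBounded_dualMulMap f, fun _ _ => rfl⟩
  · ext g
    constructor
    · rintro ⟨G, ⟨hG0, hGF⟩, rfl⟩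
      exact ⟨bidualMul_nonneg hG0 hf, fun a ha => hGF _ (dualMul_nonneg hf ha)⟩
    · rintro ⟨hg0, hg⟩
      obtain ⟨G, hG0, hGF, rfl⟩ := exists_bidualMul_eq hf hF hg0 hg
      exact ⟨G, ⟨hG0, hGF⟩, rfl⟩
  -- The only place where separation of points is used.
  · change f (b * a) = f (a * b)
    rw [FAlgebra.mul_comm_of_separating hA]
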